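/- A (directed) graph $G$ consists of a finite set $\mathcal V(G)$ of vertices and a finite set $\mathcal E(G)$ of edges, each edge having a source and a target vertex (loops and multiple edges are allowed). $G$ is irreducible if for all vertices $I,J$ there is a directed path (possibly empty) from $I$ to $J$, and weakly connected if any vertex can be reached from any other by traversing edges in either direction. $\lambda_G$ denotes the spectral radius of the adjacency matrix of $G$, whose $(I,J)$ entry is the number of edges from $I$ to $J$. A homomorphism $\Phi: G\to H$ is a pair of maps $\Phi_{\mathcal V}:\mathcal V(G)\to\mathcal V(H)$, $\Phi_{\mathcal E}:\mathcal E(G)\to\mathcal E(H)$ respecting sources and targets. It is bi-resolving (resp. bi-covering) if for each vertex $I$ of $G$ the map $\Phi_{\mathcal E}$ is injective (resp. bijective) from the set of edges starting at $I$ to the set of edges starting at $\Phi_{\mathcal V}(I)$, and likewise from the set of edges ending at $I$ to the set of edges ending at $\Phi_{\mathcal V}(I)$. Its degree is $\deg\Phi=\max_{I\in\mathcal V(H)}|\Phi_{\mathcal V}^{-1}(I)|$. An extension of $\Phi$ is a homomorphism $\tilde\Phi:\tilde G\to H$ such that $\tilde G$ contains $G$ as a subgraph and $\tilde\Phi|_G=\Phi$.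 **Theorem.** Let $\Phi: G\to H$ be a bi-resolving homomorphism of graphs with $H$ irreducible, and let $d=\deg\Phi$. 1. If $G$ is weakly connected, then there exists a bi-covering extension $\tilde\Phi:\tilde G\to H$ of $\Phi$ with $\tilde G$ irreducible and $\deg\tilde\Phi=d$. 2. If $\lambda_H>\lambda_G$ and $n>d$ is an integer, then there exists a bi-covering extension $\tilde\Phi:\tilde G\to H$ of $\Phi$ with $\tilde G$ irreducible and $\deg\tilde\Phi=n$. -/

import Mathlib

universe u

/-- A finite directed graph: finitely many vertices and edges, each edge with a source and a
target. Loops and parallel edges are allowed. -/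
structure FinDigraph where
  V : Type u
  E : Type u
  [fintypeV : Fintype V]
  [fintypeE : Fintype E]
  src : E → V
  tgt : E → V

namespace FinDigraph

attribute [instance] FinDigraph.fintypeV FinDigraph.fintypeE

/-- The edges starting from the vertex `I`. -/
def outEdges (G : FinDigraph.{u}) (I : G.V) : Set G.E := {e | G.src e = I}

/-- The edges ending at the vertex `I`. -/
def inEdges (G : FinDigraph.{u}) (I : G.V) : Set G.E := {e | G.tgt e = I}

/-- Some edge goes from `I` to `J`. -/
def Adj (G : FinDigraph.{u}) (I J : G.V) : Prop := ∃ e : G.E, G.src e = I ∧ G.tgt e = J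

/-- Every vertex can be reached from every vertex by a directed path (the empty path at a vertex
is allowed). -/
def Irreducible (G : FinDigraph.{u}) : Prop :=
  ∀ I J : G.V, Relation.ReflTransGen G.Adj I J

/-- Every vertex can be reached from every vertex by traversing edges in either direction. -/
def WeaklyConnected (G : FinDigraph.{u}) : Prop :=
  ∀ I J : G.V, Relation.ReflTransGen (fun x y => G.Adj x y ∨ G.Adj y x) I J

/-- The adjacency matrix: the entry at `(I, J)` is the number of edges from `I` to `J`. -/
noncomputable def adjMatrix (G : FinDigraph.{u}) : Matrix G.V G.V ℂ :=
  Matrix.of fun I J => (Nat.card {e : G.E // G.src e = I ∧ G.tgt e = J} : ℂ)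

open Classical in
/-- The spectral radius of the adjacency matrix: the largest modulus of a complex eigenvalue. -/
noncomputable def specRadius (G : FinDigraph.{u}) : ENNReal :=
  spectralRadius ℂ G.adjMatrix

/-- A graph homomorphism: a vertex map and an edge map that respect sources and targets. -/
structure Hom (G H : FinDigraph.{u}) where
  onV : G.V → H.V
  onE : G.E → H.E
  src_onE : ∀ e, H.src (onE e) = onV (G.src e)
  tgt_onE : ∀ e, H.tgt (onE e) = onV (G.tgt e)

namespace Hom

variable {G G' H : FinDigraph.{u}}

def RightResolving (Φ : Hom G H) : Prop :=
  ∀ I : G.V, Set.InjOn Φ.onE (G.outEdges I)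

def LeftResolving (Φ : Hom G H) : Prop :=
  ∀ I : G.V, Set.InjOn Φ.onE (G.inEdges I)

def RightCovering (Φ : Hom G H) : Prop :=
  ∀ I : G.V, Set.BijOn Φ.onE (G.outEdges I) (H.outEdges (Φ.onV I))

def LeftCovering (Φ : Hom G H) : Prop :=
  ∀ I : G.V, Set.BijOn Φ.onE (G.inEdges I) (H.inEdges (Φ.onV I))

def BiResolving (Φ : Hom G H) : Prop := Φ.LeftResolving ∧ Φ.RightResolving

def BiCovering (Φ : Hom G H) : Prop := Φ.LeftCovering ∧ Φ.RightCovering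

/-- The degree: the maximum over the vertices `I` of `H` of the number of vertices of `G` that are
mapped to `I`. -/
noncomputable def degree (Φ : Hom G H) : ℕ :=
  Finset.univ.sup fun I : H.V => Nat.card {v : G.V // Φ.onV v = I}

/-- `Ψ : G' → H` extends `Φ : G → H`: the graph `G` sits in `G'` as a subgraph (through a
homomorphism injective on vertices and on edges), and `Ψ` restricts to `Φ` on it. -/
def IsExtension (Ψ : Hom G' H) (Φ : Hom G H) : Prop :=
  ∃ ι : Hom G G', Function.Injective ι.onV ∧ Function.Injective ι.onE ∧
    (∀ v, Ψ.onV (ι.onV v) = Φ.onV v) ∧ (∀ e, Ψ.onE (ι.onE e) = Φ.onE e)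

end Hom

end FinDigraph

/-! Give each vertex of `G` one of `n` sheets, injectively on the fibres of `Φ`. Over an edge of
`H`, `G` then defines a partial injection of sheets; completing each to a permutation yields an
`n`-sheeted cover of `H` containing `G`. Since `H` is irreducible, forward closed sets in the cover
are also backward closed (`ForwardClosed.mem_iff`), so only connectedness is at stake. If `n` is the
degree, `G` fills some fibre, every component meets that fibre, and weak connectedness leaves one
component. If `n` is larger, choose the completion with the largest component of a vertex outside
`G`. A swap of two free edges would enlarge it (`reach_ssubset_reach_swapAt`), so all edges outside
it come from `G`. If anything is left outside, part of `G` covers `H`, eigenvectors of `H` lift to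
`G`, and `λ_H ≤ λ_G`. -/

namespace FinDigraph

open scoped Classical

/-- Two injections into a finite type differ by a permutation of it. -/
theorem exists_perm_comp_eq {X α : Type*} [Finite α] {a b : X → α}
    (ha : Function.Injective a) (hb : Function.Injective b) :
    ∃ σ : Equiv.Perm α, ∀ x, σ (a x) = b x := by
  have := Fintype.ofFinite α
  let e : {y // y ∈ Set.range a} ≃ {y // y ∈ Set.range b} :=
    (Equiv.ofInjective a ha).symm.trans (Equiv.ofInjective b hb)
  refine ⟨e.extendSubtype, fun x => ?_⟩
  rw [Equiv.extendSubtype_apply_of_mem e (a x) ⟨x, rfl⟩]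
  have : (⟨a x, ⟨x, rfl⟩⟩ : {y // y ∈ Set.range a}) = Equiv.ofInjective a ha x := rfl
  rw [this]
  simp [e]

/-! ### Covers of `H` given by sheet permutations. -/

variable {G H : FinDigraph.{u}} {n : ℕ}

/-- The `n`-sheeted covering graph of `H` in which the edge `e` acts on the sheets by `σ e`. -/
def cover (H : FinDigraph.{u}) {n : ℕ} (σ : H.E → Equiv.Perm (Fin n)) : FinDigraph.{u} where
  V := H.V × Fin n
  E := H.E × Fin n
  src p := (H.src p.1, p.2)
  tgt p := (H.tgt p.1, σ p.1 p.2)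

/-- The projection of a covering graph to its base. -/
def coverHom (H : FinDigraph.{u}) {n : ℕ} (σ : H.E → Equiv.Perm (Fin n)) :
    Hom (H.cover σ) H where
  onV := Prod.fst
  onE := Prod.fst
  src_onE _ := rfl
  tgt_onE _ := rfl

theorem coverHom_biCovering (σ : H.E → Equiv.Perm (Fin n)) : (H.coverHom σ).BiCovering := by
  constructor
  · rintro ⟨I, k⟩
    refine ⟨?_, ?_, ?_⟩
    · rintro ⟨e, l⟩ h
      exact congrArg Prod.fst (show (H.tgt e, σ e l) = (I, k) from h)
    · rintro ⟨e, l⟩ h ⟨e', l'⟩ h' (hee : e = e')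
      subst hee
      have h1 : (H.tgt e, σ e l) = (I, k) := h
      have h2 : (H.tgt e, σ e l') = (I, k) := h'
      have h3 := congrArg Prod.snd (h1.trans h2.symm)
      exact congrArg (Prod.mk e) ((σ e).injective h3)
    · intro e he
      refine ⟨(e, (σ e).symm k), ?_, rfl⟩
      exact Prod.ext he ((σ e).apply_symm_apply k)
  · rintro ⟨I, k⟩
    refine ⟨?_, ?_, ?_⟩
    · rintro ⟨e, l⟩ h
      exact congrArg Prod.fst (show (H.src e, l) = (I, k) from h)
    · rintro ⟨e, l⟩ h ⟨e', l'⟩ h' (hee : e = e')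
      subst hee
      have h1 : (H.src e, l) = (I, k) := h
      have h2 : (H.src e, l') = (I, k) := h'
      exact congrArg (Prod.mk e) (congrArg Prod.snd (h1.trans h2.symm))
    · intro e he
      exact ⟨(e, k), Prod.ext he rfl, rfl⟩

theorem coverHom_degree [Nonempty H.V] (σ : H.E → Equiv.Perm (Fin n)) :
    (H.coverHom σ).degree = n := by
  have h : ∀ I : H.V, Nat.card {v : (H.cover σ).V // (H.coverHom σ).onV v = I} = n := by
    intro I
    have e : {v : (H.cover σ).V // (H.coverHom σ).onV v = I} ≃ Fin n :=
      { toFun := fun v => v.1.2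
        invFun := fun k => ⟨(I, k), rfl⟩
        left_inv := by rintro ⟨⟨J, k⟩, rfl⟩; rfl
        right_inv := fun _ => rfl }
    rw [Nat.card_congr e, Nat.card_fin]
  unfold Hom.degree
  simp_rw [h]
  exact Finset.sup_const Finset.univ_nonempty n

/-! ### Embedding `G` in a cover. -/

theorem card_fiber_le_degree (Φ : Hom G H) (I : H.V) :
    Nat.card {v : G.V // Φ.onV v = I} ≤ Φ.degree :=
  Finset.le_sup (f := fun I : H.V => Nat.card {v : G.V // Φ.onV v = I}) (Finset.mem_univ I)

/-- A labelling of the vertices of `G` by sheets, injective on each fibre of `Φ`. -/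
def Hom.IsLabelling (Φ : Hom G H) (j : G.V → Fin n) : Prop :=
  ∀ v w, Φ.onV v = Φ.onV w → j v = j w → v = w

/-- The sheet permutations `σ` extend the partial injections given by the edges of `G`. -/
def Hom.Compatible (Φ : Hom G H) (j : G.V → Fin n) (σ : H.E → Equiv.Perm (Fin n)) : Prop :=
  ∀ g, σ (Φ.onE g) (j (G.src g)) = j (G.tgt g)

theorem exists_labelling (Φ : Hom G H) (hn : Φ.degree ≤ n) :
    ∃ j : G.V → Fin n, Φ.IsLabelling j := by
  have h : ∀ I : H.V, Nonempty ({v : G.V // Φ.onV v = I} ↪ Fin n) := fun I => by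
    rw [Function.Embedding.nonempty_iff_card_le, Fintype.card_fin, ← Nat.card_eq_fintype_card]
    exact (card_fiber_le_degree Φ I).trans hn
  let F := fun I => (h I).some
  refine ⟨fun v => F (Φ.onV v) ⟨v, rfl⟩, fun v w hvw hj => ?_⟩
  have key : ∀ I (hv : Φ.onV v = I) (hw : Φ.onV w = I), F I ⟨v, hv⟩ = F I ⟨w, hw⟩ → v = w :=
    fun I hv hw h => congrArg Subtype.val ((F I).injective h)
  have aux : ∀ I (hw : Φ.onV w = I), F (Φ.onV w) ⟨w, rfl⟩ = F I ⟨w, hw⟩ := by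
    rintro I rfl; rfl
  exact key _ rfl hvw.symm (hj.trans (aux _ hvw.symm))

/-- Over a fixed edge of `H`, right resolving makes an edge of `G` determined by its source sheet,
left resolving by its target sheet. -/
theorem exists_compatible {Φ : Hom G H} (hΦ : Φ.BiResolving) {j : G.V → Fin n}
    (hj : Φ.IsLabelling j) : ∃ σ, Φ.Compatible j σ := by
  have h : ∀ e : H.E, ∃ τ : Equiv.Perm (Fin n), ∀ g : {g : G.E // Φ.onE g = e},
      τ (j (G.src g)) = j (G.tgt g) := fun e => by
    apply exists_perm_comp_eq (X := {g : G.E // Φ.onE g = e})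
      (a := fun g => j (G.src g)) (b := fun g => j (G.tgt g))
    · rintro ⟨g, rfl⟩ ⟨g', hg⟩ h
      have hs : G.src g = G.src g' := hj _ _ (by rw [← Φ.src_onE, ← Φ.src_onE, hg]) h
      exact Subtype.ext (hΦ.2 _ (show G.src g = _ from rfl) (show G.src g' = _ from hs.symm)
        hg.symm)
    · rintro ⟨g, rfl⟩ ⟨g', hg⟩ h
      have hs : G.tgt g = G.tgt g' := hj _ _ (by rw [← Φ.tgt_onE, ← Φ.tgt_onE, hg]) h
      exact Subtype.ext (hΦ.1 _ (show G.tgt g = _ from rfl) (show G.tgt g' = _ from hs.symm)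
        hg.symm)
  choose σ hσ using h
  exact ⟨σ, fun g => hσ _ ⟨g, rfl⟩⟩

theorem coverHom_isExtension {Φ : Hom G H} (hΦ : Φ.BiResolving) {j : G.V → Fin n}
    (hj : Φ.IsLabelling j) {σ : H.E → Equiv.Perm (Fin n)} (hσ : Φ.Compatible j σ) :
    (H.coverHom σ).IsExtension Φ := by
  refine ⟨⟨fun v => (Φ.onV v, j v), fun g => (Φ.onE g, j (G.src g)), fun g => ?_, fun g => ?_⟩,
    ?_, ?_, fun _ => rfl, fun _ => rfl⟩
  · exact Prod.ext (Φ.src_onE g) rfl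
  · exact Prod.ext (Φ.tgt_onE g) (hσ g)
  · intro v w h
    exact hj v w (congrArg Prod.fst h) (congrArg Prod.snd h)
  · intro g g' h
    have h1 : Φ.onE g = Φ.onE g' := congrArg Prod.fst h
    have h2 : j (G.src g) = j (G.src g') := congrArg Prod.snd h
    have hs : G.src g = G.src g' := hj _ _ (by rw [← Φ.src_onE, ← Φ.src_onE, h1]) h2
    exact hΦ.2 _ (show G.src g = _ from rfl) (show G.src g' = _ from hs.symm) h1

/-! ### Forward closed sets and reachability. -/

/-- A set of vertices of the cover that is closed under following edges. -/
def ForwardClosed (σ : H.E → Equiv.Perm (Fin n)) (S : Set (H.V × Fin n)) : Prop :=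
  ∀ e k, (H.src e, k) ∈ S → (H.tgt e, σ e k) ∈ S

/-- The set of sheets over `I` that meet `S`. -/
noncomputable def sheets (S : Set (H.V × Fin n)) (I : H.V) : Finset (Fin n) :=
  Finset.univ.filter fun k => (I, k) ∈ S

theorem mem_sheets {S : Set (H.V × Fin n)} {I : H.V} {k : Fin n} :
    k ∈ sheets S I ↔ (I, k) ∈ S := by simp [sheets]

/-- Each `σ e` injects sheets at the source into sheets at the target, so the count cannot drop
along a path, and paths run both ways. -/
theorem ForwardClosed.card_sheets (hH : H.Irreducible) {σ : H.E → Equiv.Perm (Fin n)}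
    {S : Set (H.V × Fin n)} (hS : ForwardClosed σ S) (I J : H.V) :
    (sheets S I).card = (sheets S J).card := by
  have h : ∀ I J, (sheets S I).card ≤ (sheets S J).card := by
    intro I J
    induction hH I J with
    | refl => exact le_rfl
    | tail _ h ih =>
      obtain ⟨e, rfl, rfl⟩ := h
      refine ih.trans (Finset.card_le_card_of_injOn (σ e) ?_ (σ e).injective.injOn)
      intro k hk
      exact mem_sheets.2 (hS e k (mem_sheets.1 hk))
  exact le_antisymm (h I J) (h J I)

theorem ForwardClosed.mem_iff (hH : H.Irreducible) {σ : H.E → Equiv.Perm (Fin n)}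
    {S : Set (H.V × Fin n)} (hS : ForwardClosed σ S) (e : H.E) (k : Fin n) :
    (H.tgt e, σ e k) ∈ S ↔ (H.src e, k) ∈ S := by
  refine ⟨fun h => ?_, hS e k⟩
  have himg : (sheets S (H.src e)).image (σ e) = sheets S (H.tgt e) := by
    apply Finset.eq_of_subset_of_card_le
    · intro l hl
      obtain ⟨k, hk, rfl⟩ := Finset.mem_image.1 hl
      exact mem_sheets.2 (hS e k (mem_sheets.1 hk))
    · rw [Finset.card_image_of_injective _ (σ e).injective, hS.card_sheets hH]
  have := mem_sheets.2 h
  rw [← himg, Finset.mem_image] at this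
  obtain ⟨l, hl, hkl⟩ := this
  rw [← (σ e).injective hkl]
  exact mem_sheets.1 hl

theorem ForwardClosed.compl (hH : H.Irreducible) {σ : H.E → Equiv.Perm (Fin n)}
    {S : Set (H.V × Fin n)} (hS : ForwardClosed σ S) : ForwardClosed σ Sᶜ :=
  fun e k h h' => h ((hS.mem_iff hH e k).1 h')

/-- A forward closed set that is nonempty meets every fibre. -/
theorem ForwardClosed.exists_mem (hH : H.Irreducible) {σ : H.E → Equiv.Perm (Fin n)}
    {S : Set (H.V × Fin n)} (hS : ForwardClosed σ S) {x : H.V × Fin n} (hx : x ∈ S) (I : H.V) :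
    ∃ k, (I, k) ∈ S := by
  have h1 : 0 < (sheets S x.1).card := Finset.card_pos.2 ⟨x.2, mem_sheets.2 hx⟩
  rw [hS.card_sheets hH x.1 I, Finset.card_pos] at h1
  obtain ⟨k, hk⟩ := h1
  exact ⟨k, mem_sheets.1 hk⟩

/-- The vertices of the cover reachable from `x`. -/
def reach (σ : H.E → Equiv.Perm (Fin n)) (x : H.V × Fin n) : Set (H.V × Fin n) :=
  {y | Relation.ReflTransGen (H.cover σ).Adj x y}

theorem mem_reach_self (σ : H.E → Equiv.Perm (Fin n)) (x : H.V × Fin n) : x ∈ reach σ x :=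
  Relation.ReflTransGen.refl

theorem forwardClosed_reach (σ : H.E → Equiv.Perm (Fin n)) (x : H.V × Fin n) :
    ForwardClosed σ (reach σ x) :=
  fun e k h => Relation.ReflTransGen.tail h ⟨(e, k), rfl, rfl⟩

theorem ForwardClosed.reach_subset {σ : H.E → Equiv.Perm (Fin n)} {S : Set (H.V × Fin n)}
    (hS : ForwardClosed σ S) {x : H.V × Fin n} (hx : x ∈ S) : reach σ x ⊆ S := by
  intro y hy
  induction hy with
  | refl => exact hx
  | tail _ h ih =>
    obtain ⟨⟨e, k⟩, rfl, rfl⟩ := h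
    exact hS e k ih

theorem cover_irreducible_of_reach_eq_univ (hH : H.Irreducible) {σ : H.E → Equiv.Perm (Fin n)}
    {x : H.V × Fin n} (hx : reach σ x = Set.univ) : (H.cover σ).Irreducible := by
  intro y z
  have hxy : x ∈ reach σ y := by
    by_contra h
    have hc := ((forwardClosed_reach σ y).compl hH).reach_subset h
    rw [hx] at hc
    exact hc (Set.mem_univ y) (mem_reach_self σ y)
  have hz : z ∈ reach σ x := hx ▸ Set.mem_univ _
  exact Relation.ReflTransGen.trans hxy hz

/-- A forward closed set containing one vertex of a weakly connected `G` contains all of them. -/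
theorem ForwardClosed.mem_of_weaklyConnected (hH : H.Irreducible) {Φ : Hom G H}
    {j : G.V → Fin n} {σ : H.E → Equiv.Perm (Fin n)} (hσ : Φ.Compatible j σ)
    (hG : G.WeaklyConnected) {S : Set (H.V × Fin n)} (hS : ForwardClosed σ S) {v : G.V}
    (hv : (Φ.onV v, j v) ∈ S) (w : G.V) : (Φ.onV w, j w) ∈ S := by
  have edge : ∀ g : G.E, (Φ.onV (G.tgt g), j (G.tgt g)) ∈ S ↔
      (Φ.onV (G.src g), j (G.src g)) ∈ S := fun g => by
    rw [← hσ g, ← Φ.src_onE, ← Φ.tgt_onE]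
    exact hS.mem_iff hH _ _
  induction hG v w with
  | refl => exact hv
  | tail _ h ih =>
    rcases h with ⟨g, rfl, rfl⟩ | ⟨g, rfl, rfl⟩
    · exact (edge g).2 ih
    · exact (edge g).1 ih

/-! ### The weakly connected case. -/

theorem exists_biCovering_of_weaklyConnected (Φ : Hom G H) (hΦ : Φ.BiResolving)
    (hH : H.Irreducible) (hG : G.WeaklyConnected) :
    ∃ (G' : FinDigraph.{u}) (Ψ : Hom G' H),
      Ψ.BiCovering ∧ Ψ.IsExtension Φ ∧ G'.Irreducible ∧ Ψ.degree = Φ.degree := by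
  obtain ⟨j, hj⟩ := exists_labelling Φ le_rfl
  obtain ⟨σ, hσ⟩ := exists_compatible hΦ hj
  refine ⟨H.cover σ, H.coverHom σ, coverHom_biCovering σ, coverHom_isExtension hΦ hj hσ, ?_, ?_⟩
  · rintro x y
    have : Nonempty H.V := ⟨x.1⟩
    obtain ⟨I, -, hI⟩ := Finset.exists_mem_eq_sup (Finset.univ : Finset H.V)
      Finset.univ_nonempty fun I : H.V => Nat.card {v : G.V // Φ.onV v = I}
    -- Over `I` the degree is attained, so `G` occupies every sheet.
    have hsurj : ∀ k, ∃ v, Φ.onV v = I ∧ j v = k := by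
      have hb : Function.Bijective (fun v : {v : G.V // Φ.onV v = I} => j v.1) := by
        rw [Fintype.bijective_iff_injective_and_card]
        refine ⟨?_, ?_⟩
        · rintro ⟨v, hv⟩ ⟨w, hw⟩ h
          exact Subtype.ext (hj v w (hv.trans hw.symm) h)
        · rw [Fintype.card_fin, ← Nat.card_eq_fintype_card]
          exact hI.symm
      intro k
      obtain ⟨⟨v, hv⟩, h⟩ := hb.2 k
      exact ⟨v, hv, h⟩
    have hS := forwardClosed_reach σ x
    obtain ⟨k, hk⟩ := hS.exists_mem hH (mem_reach_self σ x) I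
    obtain ⟨v, rfl, rfl⟩ := hsurj k
    by_contra hy
    obtain ⟨l, hl⟩ := (hS.compl hH).exists_mem hH (x := y) hy (Φ.onV v)
    obtain ⟨w, hw, rfl⟩ := hsurj l
    rw [← hw] at hl
    exact hl (hS.mem_of_weaklyConnected hH hσ hG hk w)
  · rcases isEmpty_or_nonempty H.V with h | h
    · simp [Hom.degree]
    · exact coverHom_degree σ

/-! ### Enlarging a component by a swap. -/

/-- No edge of `G` labelled by the sheet `k` lies over `e`. -/
def Hom.IsFree (Φ : Hom G H) (j : G.V → Fin n) (e : H.E) (k : Fin n) : Prop :=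
  ∀ g, Φ.onE g = e → j (G.src g) ≠ k

/-- Interchange the sheets `a` and `b` in the action of the edge `e`. -/
noncomputable def swapAt (σ : H.E → Equiv.Perm (Fin n)) (e : H.E) (a b : Fin n) :
    H.E → Equiv.Perm (Fin n) :=
  Function.update σ e ((Equiv.swap a b).trans (σ e))

theorem swapAt_apply_of_not {σ : H.E → Equiv.Perm (Fin n)} {e f : H.E} {a b k : Fin n}
    (h : f = e → k ≠ a ∧ k ≠ b) : swapAt σ e a b f k = σ f k := by
  by_cases hf : f = e
  · subst hf
    simp [swapAt, Equiv.swap_apply_of_ne_of_ne (h rfl).1 (h rfl).2]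
  · simp [swapAt, hf]

theorem swapAt_apply_left (σ : H.E → Equiv.Perm (Fin n)) (e : H.E) (a b : Fin n) :
    swapAt σ e a b e a = σ e b := by simp [swapAt]

theorem Hom.Compatible.swapAt {Φ : Hom G H} {j : G.V → Fin n} {σ : H.E → Equiv.Perm (Fin n)}
    (hσ : Φ.Compatible j σ) {e : H.E} {a b : Fin n} (ha : Φ.IsFree j e a)
    (hb : Φ.IsFree j e b) : Φ.Compatible j (swapAt σ e a b) := fun g => by
  rw [swapAt_apply_of_not fun h => ⟨ha g h, hb g h⟩]
  exact hσ g

/-- Interchanging two edges over `e`, one inside the component of `x` and one outside,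
enlarges that component. -/
theorem reach_ssubset_reach_swapAt (hH : H.Irreducible) {σ : H.E → Equiv.Perm (Fin n)}
    {x : H.V × Fin n} {e : H.E} {a b : Fin n} (ha : (H.src e, a) ∈ reach σ x)
    (hb : (H.src e, b) ∉ reach σ x) : reach σ x ⊂ reach (swapAt σ e a b) x := by
  set A := reach σ x
  set A' := reach (swapAt σ e a b) x
  have cA : ForwardClosed σ A := forwardClosed_reach σ x
  have cA' : ForwardClosed (swapAt σ e a b) A' := forwardClosed_reach _ x
  have xA : x ∈ A := mem_reach_self σ x
  have xA' : x ∈ A' := mem_reach_self _ x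
  -- Within `A` only the edge `(e, a)` is changed, as `(H.src e, b)` lies outside.
  have step : ∀ f k, (f, k) ≠ (e, a) → (H.src f, k) ∈ A →
      swapAt σ e a b f k = σ f k := by
    intro f k hne hk
    refine swapAt_apply_of_not ?_
    rintro rfl
    exact ⟨fun h => hne (by rw [h]), fun h => hb (h ▸ hk)⟩
  -- Otherwise `A ∩ A'` avoids the changed edge, is closed under `σ`, and so contains all of `A`.
  have pA' : (H.src e, a) ∈ A' := by
    by_contra hp
    have hc : ForwardClosed σ (A ∩ A') := by
      rintro f k ⟨h1, h2⟩
      refine ⟨cA f k h1, ?_⟩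
      rw [← step f k ?_ h1]
      · exact cA' f k h2
      · intro h
        obtain ⟨rfl, rfl⟩ := Prod.mk.inj h
        exact hp h2
    exact hp (hc.reach_subset ⟨xA, xA'⟩ ha).2
  -- The same argument along reversed edges.
  have qA' : (H.tgt e, σ e a) ∈ A' := by
    by_contra hq
    have hc : ForwardClosed σ (A ∩ A')ᶜ := by
      intro f k h h'
      have h1 : (H.src f, k) ∈ A := (cA.mem_iff hH f k).1 h'.1
      refine h ⟨h1, ?_⟩
      rw [← cA'.mem_iff hH f k, step f k ?_ h1]
      · exact h'.2
      · intro hh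
        obtain ⟨rfl, rfl⟩ := Prod.mk.inj hh
        exact hq h'.2
    have hc' := hc.compl hH
    rw [compl_compl] at hc'
    exact hq (hc'.reach_subset ⟨xA, xA'⟩ (cA e a ha)).2
  have hsub : A ⊆ A' := by
    have hc : ForwardClosed σ (A ∩ A') := by
      rintro f k ⟨h1, h2⟩
      refine ⟨cA f k h1, ?_⟩
      by_cases hfk : (f, k) = (e, a)
      · obtain ⟨rfl, rfl⟩ := Prod.mk.inj hfk
        exact qA'
      · rw [← step f k hfk h1]
        exact cA' f k h2
    exact fun y hy => (hc.reach_subset ⟨xA, xA'⟩ hy).2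
  refine ⟨hsub, fun h => ?_⟩
  -- The rerouted edge leads from `(H.src e, a)` out of `A`.
  have h1 := cA' e a pA'
  rw [swapAt_apply_left] at h1
  exact hb ((cA.mem_iff hH e b).1 (h h1))

/-! ### Comparison of spectral radii. -/

theorem adjMatrix_mulVec (G : FinDigraph.{u}) (y : G.V → ℂ) (v : G.V) :
    G.adjMatrix.mulVec y v = ∑ g with G.src g = v, y (G.tgt g) := by
  have h : ∀ w, G.adjMatrix v w * y w =
      ∑ g with G.src g = v, if G.tgt g = w then y w else 0 := by
    intro w
    rw [← Finset.sum_filter, Finset.sum_const, Finset.filter_filter, nsmul_eq_mul]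
    simp [adjMatrix, Nat.card_eq_fintype_card, Fintype.card_subtype]
  rw [Matrix.mulVec, dotProduct, Finset.sum_congr rfl fun w _ => h w, Finset.sum_comm]
  simp

theorem mem_spectrum_iff_exists_mulVec {ι : Type*} [Fintype ι] (A : Matrix ι ι ℂ) (μ : ℂ) :
    μ ∈ spectrum ℂ A ↔ ∃ x ≠ 0, A.mulVec x = μ • x := by
  rw [spectrum.mem_iff, Matrix.isUnit_iff_isUnit_det, isUnit_iff_ne_zero, not_not,
    ← Matrix.exists_mulVec_eq_zero_iff]
  refine exists_congr fun x => and_congr_right fun _ => ?_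
  rw [Matrix.sub_mulVec, sub_eq_zero, Matrix.algebraMap_eq_diagonal, eq_comm]
  have : (Matrix.diagonal (algebraMap ℂ (ι → ℂ) μ)).mulVec x = μ • x := by
    ext i
    simp [Matrix.mulVec_diagonal]
  rw [this]

/-- If the set `B` of vertices of `G` is invariant in both directions and covers `H`, then the
spectral radius of `H` is at most that of `G`. -/
theorem specRadius_le_of_covering_subset {Φ : Hom G H} (hΦ : Φ.RightResolving) (B : Set G.V)
    (hB : ∀ g, G.tgt g ∈ B ↔ G.src g ∈ B) (hBH : ∀ I, ∃ v ∈ B, Φ.onV v = I)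
    (hlift : ∀ v ∈ B, ∀ e, H.src e = Φ.onV v → ∃ g, G.src g = v ∧ Φ.onE g = e) :
    H.specRadius ≤ G.specRadius := by
  refine biSup_mono fun μ hμ => ?_
  rw [mem_spectrum_iff_exists_mulVec] at hμ ⊢
  obtain ⟨x, hx0, hx⟩ := hμ
  -- Pull the eigenvector back to `B` and extend by zero; edges never cross the boundary of `B`.
  refine ⟨fun v => if v ∈ B then x (Φ.onV v) else 0, ?_, ?_⟩
  · obtain ⟨I, hI⟩ := Function.ne_iff.1 hx0
    obtain ⟨v, hv, rfl⟩ := hBH I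
    refine Function.ne_iff.2 ⟨v, ?_⟩
    simpa [hv] using hI
  · ext v
    rw [adjMatrix_mulVec]
    by_cases hv : v ∈ B
    · have h1 := congrFun hx (Φ.onV v)
      rw [adjMatrix_mulVec] at h1
      simp only [Pi.smul_apply, if_pos hv] at h1 ⊢
      rw [← h1]
      refine Finset.sum_bij (fun g _ => Φ.onE g) ?_ ?_ ?_ ?_
      · intro g hg
        have hg' := (Finset.mem_filter.1 hg).2
        simp [Φ.src_onE, hg']
      · intro g hg g' hg' h
        exact hΦ v (Finset.mem_filter.1 hg).2 (Finset.mem_filter.1 hg').2 h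
      · intro e he
        obtain ⟨g, hg, hge⟩ := hlift v hv e (Finset.mem_filter.1 he).2
        exact ⟨g, by simp [hg], hge⟩
      · intro g hg
        have hg' := (Finset.mem_filter.1 hg).2
        rw [if_pos ((hB g).2 (hg' ▸ hv)), Φ.tgt_onE]
    · simp only [Pi.smul_apply, if_neg hv, smul_zero]
      refine Finset.sum_eq_zero fun g hg => ?_
      have hg' := (Finset.mem_filter.1 hg).2
      exact if_neg fun h => hv (hg' ▸ (hB g).1 h)

/-! ### The case of larger spectral radius. -/

theorem exists_edge_of_specRadius_pos (h : 0 < H.specRadius) : Nonempty H.E := by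
  by_contra hE
  rw [not_nonempty_iff] at hE
  have h0 : H.adjMatrix = 0 := by
    ext I J
    simp [adjMatrix]
  rw [specRadius, h0, spectrum.spectralRadius_zero] at h
  exact lt_irrefl _ h

theorem Irreducible.exists_src_eq (hH : H.Irreducible) (e : H.E) (I : H.V) :
    ∃ f, H.src f = I := by
  rcases Relation.ReflTransGen.cases_head (hH I (H.src e)) with h | ⟨J, ⟨f, hf, -⟩, -⟩
  · exact ⟨e, h.symm⟩
  · exact ⟨f, hf⟩

theorem exists_spare_sheet (Φ : Hom G H) (j : G.V → Fin n) (hn : Φ.degree < n) (I : H.V) :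
    ∃ k, ∀ v, Φ.onV v = I → j v ≠ k := by
  by_contra! h
  have hs : Function.Surjective (fun v : {v : G.V // Φ.onV v = I} => j v.1) := fun k => by
    obtain ⟨v, hv, hk⟩ := h k
    exact ⟨⟨v, hv⟩, hk⟩
  have hc := Nat.card_le_card_of_surjective _ hs
  rw [Nat.card_fin] at hc
  exact absurd (hc.trans (card_fiber_le_degree Φ I)) (not_le.2 hn)

theorem exists_compatible_irreducible {Φ : Hom G H} (hΦ : Φ.BiResolving) (hH : H.Irreducible)
    {j : G.V → Fin n} (hj : Φ.IsLabelling j) (hlt : G.specRadius < H.specRadius)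
    (hn : Φ.degree < n) : ∃ σ, Φ.Compatible j σ ∧ (H.cover σ).Irreducible := by
  obtain ⟨e₀⟩ := exists_edge_of_specRadius_pos (bot_le.trans_lt hlt)
  choose s hs using exists_spare_sheet Φ j hn
  let I₀ := H.src e₀
  let x : H.V × Fin n := (I₀, s I₀)
  obtain ⟨σ, hσ, hmax⟩ := Set.exists_max_image {σ | Φ.Compatible j σ}
    (fun σ => (reach σ x).ncard) (Set.toFinite _) (exists_compatible hΦ hj)
  refine ⟨σ, hσ, cover_irreducible_of_reach_eq_univ hH (x := x) ?_⟩
  have hA := forwardClosed_reach σ x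
  have hfree : ∀ e a b, Φ.IsFree j e a → Φ.IsFree j e b → (H.src e, a) ∈ reach σ x →
      (H.src e, b) ∈ reach σ x := by
    intro e a b ha hb haA
    by_contra hbA
    have h1 := Set.ncard_lt_ncard (reach_ssubset_reach_swapAt hH haA hbA) (Set.toFinite _)
    exact absurd (hmax _ (hσ.swapAt ha hb)) (not_le.2 h1)
  have hspare : ∀ e, Φ.IsFree j e (s (H.src e)) := fun e g hg =>
    hs _ _ (by rw [← Φ.src_onE, hg])
  have hsA : ∀ I, (I, s I) ∈ reach σ x := by
    intro I
    induction hH I₀ I with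
    | refl => exact mem_reach_self σ x
    | tail _ h ih =>
      obtain ⟨e, rfl, rfl⟩ := h
      -- The edge over `e` into a spare vertex is not in `G`, so its source sheet is free, hence
      -- reached together with the spare sheet there.
      have hb : Φ.IsFree j e ((σ e).symm (s (H.tgt e))) := by
        rintro g rfl hg
        rw [Equiv.eq_symm_apply, hσ g] at hg
        exact hs _ _ (Φ.tgt_onE g).symm hg
      simpa using hA e _ (hfree e _ _ (hspare e) hb ih)
  by_contra hne
  obtain ⟨z, hz⟩ := (Set.ne_univ_iff_exists_notMem _).1 hne
  -- A free edge outside the component could be swapped with the one at the spare sheet.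
  have hold : ∀ e k, (H.src e, k) ∉ reach σ x → ∃ g, Φ.onE g = e ∧ j (G.src g) = k := by
    intro e k hk
    by_contra! h
    exact hk (hfree e _ _ (hspare e) h (hsA _))
  refine absurd (specRadius_le_of_covering_subset hΦ.2
    {v | (Φ.onV v, j v) ∉ reach σ x} ?_ ?_ ?_) (not_le.2 hlt)
  · intro g
    have := hA.mem_iff hH (Φ.onE g) (j (G.src g))
    rw [hσ g, Φ.tgt_onE, Φ.src_onE] at this
    exact not_congr this
  · intro I
    obtain ⟨k, hk⟩ := (hA.compl hH).exists_mem hH hz I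
    -- An outgoing edge is needed: a vertex outside the component is known to lie in `G` only as the
    -- source of an edge of `G`.
    obtain ⟨f, rfl⟩ := hH.exists_src_eq e₀ I
    obtain ⟨g, rfl, rfl⟩ := hold f k hk
    refine ⟨G.src g, ?_, (Φ.src_onE g).symm⟩
    rw [Φ.src_onE] at hk
    exact hk
  · intro v hv e he
    obtain ⟨g, hg, hgj⟩ := hold e (j v) (he ▸ hv)
    exact ⟨g, hj _ _ (by rw [← Φ.src_onE, hg, he]) hgj, hg⟩

theorem exists_biCovering_of_specRadius_lt (Φ : Hom G H) (hΦ : Φ.BiResolving)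
    (hH : H.Irreducible) (hlt : G.specRadius < H.specRadius) (hn : Φ.degree < n) :
    ∃ (G' : FinDigraph.{u}) (Ψ : Hom G' H),
      Ψ.BiCovering ∧ Ψ.IsExtension Φ ∧ G'.Irreducible ∧ Ψ.degree = n := by
  obtain ⟨j, hj⟩ := exists_labelling Φ hn.le
  obtain ⟨σ, hσ, hirr⟩ := exists_compatible_irreducible hΦ hH hj hlt hn
  obtain ⟨e⟩ := exists_edge_of_specRadius_pos (bot_le.trans_lt hlt)
  have : Nonempty H.V := ⟨H.src e⟩
  exact ⟨H.cover σ, H.coverHom σ, coverHom_biCovering σ, coverHom_isExtension hΦ hj hσ, hirr,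
    coverHom_degree σ⟩

end FinDigraph

theorem theorem3p3 {G H : FinDigraph.{u}} (Φ : FinDigraph.Hom G H)
    (hΦ : Φ.BiResolving) (hH : H.Irreducible) :
    (G.WeaklyConnected →
      ∃ (G' : FinDigraph.{u}) (Ψ : FinDigraph.Hom G' H),
        Ψ.BiCovering ∧ Ψ.IsExtension Φ ∧ G'.Irreducible ∧ Ψ.degree = Φ.degree) ∧
    (∀ n : ℕ, G.specRadius < H.specRadius → Φ.degree < n →
      ∃ (G' : FinDigraph.{u}) (Ψ : FinDigraph.Hom G' H),
        Ψ.BiCovering ∧ Ψ.IsExtension Φ ∧ G'.Irreducible ∧ Ψ.degree = n) :=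
  ⟨FinDigraph.exists_biCovering_of_weaklyConnected Φ hΦ hH,
    fun _ => FinDigraph.exists_biCovering_of_specRadius_lt Φ hΦ hH⟩
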